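/- A Seidel matrix of order $n$ is a symmetric $n\times n$ integer matrix with zeros on the diagonal and all other entries equal to $\pm 1$; its characteristic polynomial is $\chi_S(x)=\det(xI-S)\in\mathbb Z[x]$. Let $\mathcal P$ be the set of congruence classes modulo $32\,\mathbb Z[x]$ of the polynomials $\chi_S(x)$, where $S$ ranges over all Seidel matrices of order $49$, that is, $\mathcal P=\{\chi_S(x)+32\,\mathbb Z[x] : S \text{ a Seidel matrix of order } 49\}$. Then $\mathcal P$ has exactly $16$ elements. -/

import Mathlib

open Polynomial

/-- A Seidel matrix: a symmetric integer matrix with zeros on the diagonal and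
all other entries equal to `1` or `-1`. -/
structure IsSeidelMatrix {ι : Type*} (S : Matrix ι ι ℤ) : Prop where
  isSymm : S.IsSymm
  diag_eq_zero : ∀ i, S i i = 0
  off_diag : ∀ i j, i ≠ j → S i j = 1 ∨ S i j = -1

/-- The set of congruence classes modulo `m ℤ[x]` of the characteristic polynomials
`det (x I - S)` of the Seidel matrices `S` of order `n`. -/
def seidelCharpolyClasses (n : ℕ) (m : ℤ) : Set (ℤ[X] ⧸ Ideal.span {(C m : ℤ[X])}) :=
  {q | ∃ S : Matrix (Fin n) (Fin n) ℤ,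
    IsSeidelMatrix S ∧ Ideal.Quotient.mk (Ideal.span {(C m : ℤ[X])}) S.charpoly = q}

/-! Since 49 is odd, every switching class contains a graph with all degrees even, so up to
similarity S = J - I - 2A with A Eulerian. Shifting by I and reversing lose nothing modulo 32, so it
suffices to study det(1 - z(J - 2A)). This equals det(1 + 2zA) times a rank-one correction in the
walk counts 1ᵀAʲ1; since 2⁵ = 32, only terms with at most four factors 2z survive. Newton's
identities and the congruences for tr A⁴ and for walks in Eulerian graphs reduce everything to the
number e of edges and t of triangles (`IsEulerAdj.charpolyRev_map`). The result depends exactly on e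
mod 8 and t mod 2, and all 16 pairs are realised by a cycle with or without a disjoint triangle. -/

/-! ### Divisibility of symmetric sums -/

theorem sum_sum_eq_two_mul_of_symm {ι : Type*} [Fintype ι] [LinearOrder ι] (f : ι → ι → ℤ)
    (hs : ∀ i j, f i j = f j i) (hd : ∀ i, f i i = 0) :
    ∑ i, ∑ j, f i j = 2 * ∑ i, ∑ j, if i < j then f i j else 0 := by
  have h1 : ∀ i j, f i j = (if i < j then f i j else 0) + (if j < i then f j i else 0) := by
    intro i j
    rcases lt_trichotomy i j with h | h | h
    · simp [h, h.not_gt]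
    · subst h; simp [hd]
    · simp [h, h.not_gt, hs i j]
  have h2 : ∑ i, ∑ j, (if j < i then f j i else 0) = ∑ i, ∑ j, if i < j then f i j else 0 :=
    Finset.sum_comm
  calc ∑ i, ∑ j, f i j
      = ∑ i, ∑ j, ((if i < j then f i j else 0) + (if j < i then f j i else 0)) :=
        Finset.sum_congr rfl fun i _ => Finset.sum_congr rfl fun j _ => h1 i j
    _ = _ := by simp only [Finset.sum_add_distrib, h2, two_mul]

theorem two_dvd_sum_sum_of_symm {ι : Type*} [Fintype ι] (f : ι → ι → ℤ)
    (hs : ∀ i j, f i j = f j i) (hd : ∀ i, f i i = 0) : 2 ∣ ∑ i, ∑ j, f i j := by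
  classical
  let _ : LinearOrder ι := linearOrderOfSTO WellOrderingRel
  exact ⟨_, sum_sum_eq_two_mul_of_symm f hs hd⟩

/-- The three symmetries generate a dihedral group of order 8, and `h` vanishes wherever its action
is not free. -/
theorem eight_dvd_sum_of_symm {ι : Type*} [Fintype ι] (h : ι → ι → ι → ι → ℤ)
    (h₁ : ∀ i k j l, h i k j l = h k i j l) (h₂ : ∀ i k j l, h i k j l = h i k l j)
    (h₃ : ∀ i k j l, h i k j l = h j l i k) (hd : ∀ i j l, h i i j l = 0)
    (hz : ∀ i k, h i k i k = 0) : 8 ∣ ∑ i, ∑ k, ∑ j, ∑ l, h i k j l := by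
  classical
  let _ : LinearOrder ι := linearOrderOfSTO WellOrderingRel
  have e₁ : ∀ i k, ∑ j, ∑ l, h i k j l = 2 * ∑ j, ∑ l, if j < l then h i k j l else 0 :=
    fun i k => sum_sum_eq_two_mul_of_symm _ (h₂ i k) fun j => by rw [h₃, hd]
  have e₂ : ∑ i, ∑ k, ∑ j, ∑ l, h i k j l =
      2 * ∑ i, ∑ k, if i < k then ∑ j, ∑ l, h i k j l else 0 :=
    sum_sum_eq_two_mul_of_symm (fun i k => ∑ j, ∑ l, h i k j l)
      (fun i k => by simp only [h₁ i k]) fun i => by simp [hd]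
  have e₃ := two_dvd_sum_sum_of_symm
    (fun p q : ι × ι => if p.1 < p.2 then if q.1 < q.2 then h p.1 p.2 q.1 q.2 else 0 else 0)
    (fun p q => by
      by_cases hp : p.1 < p.2 <;> by_cases hq : q.1 < q.2 <;> simp [hp, hq, h₃ p.1])
    (fun p => by simp [hz])
  obtain ⟨m, hm⟩ := e₃
  simp only [Fintype.sum_prod_type] at hm
  have e₄ : ∑ i, ∑ k, (if i < k then ∑ j, ∑ l, h i k j l else 0) =
      2 * ∑ i, ∑ k, ∑ j, ∑ l, (if i < k then if j < l then h i k j l else 0 else 0) := by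
    simp only [Finset.mul_sum]
    refine Finset.sum_congr rfl fun i _ => Finset.sum_congr rfl fun k _ => ?_
    split_ifs
    · rw [e₁]; simp only [Finset.mul_sum]
    · simp
  rw [e₂, e₄, hm]
  exact ⟨m, by ring⟩

/-! ### Closed walks in Eulerian graphs -/

/-- The adjacency matrix over `ℤ` of a simple graph, all of whose degrees are even. -/
structure IsEulerAdj {ι : Type*} [Fintype ι] (A : Matrix ι ι ℤ) : Prop where
  symm : ∀ i j, A i j = A j i
  diag : ∀ i, A i i = 0
  zero_or_one : ∀ i j, A i j = 0 ∨ A i j = 1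
  even : ∀ i, 2 ∣ ∑ j, A i j

namespace IsEulerAdj
variable {ι : Type*} [Fintype ι] {A : Matrix ι ι ℤ}

theorem isSymm (hA : IsEulerAdj A) : A.IsSymm :=
  Matrix.IsSymm.ext fun i j => hA.symm j i

theorem mul_self (hA : IsEulerAdj A) (i j : ι) : A i j * A i j = A i j := by
  rcases hA.zero_or_one i j with h | h <;> simp [h]

theorem trace_eq_zero (hA : IsEulerAdj A) : A.trace = 0 := by
  simp [Matrix.trace, hA.diag]

variable [DecidableEq ι]

theorem trace_sq (hA : IsEulerAdj A) : (A ^ 2).trace = ∑ i, ∑ j, A i j := by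
  simp only [Matrix.trace, pow_two, Matrix.diag_apply, Matrix.mul_apply]
  refine Finset.sum_congr rfl fun i _ => Finset.sum_congr rfl fun j _ => ?_
  rw [hA.symm j i, hA.mul_self]

theorem sq_symm (hA : IsEulerAdj A) (i j : ι) : (A ^ 2) i j = (A ^ 2) j i :=
  ((hA.isSymm.pow 2).apply i j).symm

theorem two_dvd_trace_pow_three (hA : IsEulerAdj A) : 2 ∣ (A ^ 3).trace := by
  have : (A ^ 3).trace = ∑ i, ∑ j, A i j * (A ^ 2) i j := by
    simp only [Matrix.trace, pow_succ' A 2, Matrix.diag_apply, Matrix.mul_apply (M := A)]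
    exact Finset.sum_congr rfl fun i _ => Finset.sum_congr rfl fun j _ => by rw [hA.sq_symm j i]
  rw [this]
  exact two_dvd_sum_sum_of_symm _ (fun i j => by rw [hA.symm, hA.sq_symm])
    fun i => by rw [hA.diag, zero_mul]

theorem sum_sum_sq (hA : IsEulerAdj A) :
    ∑ i, ∑ k, (A ^ 2) i k = ∑ j, (∑ i, A j i) ^ 2 := by
  simp only [pow_two, Matrix.mul_apply, Finset.sum_mul_sum]
  calc ∑ i, ∑ k, ∑ j, A i j * A j k = ∑ i, ∑ j, ∑ k, A i j * A j k :=
        Finset.sum_congr rfl fun i _ => Finset.sum_comm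
    _ = ∑ j, ∑ i, ∑ k, A i j * A j k := Finset.sum_comm
    _ = _ := by simp only [hA.symm _ (_ : ι)]

/-- Closed 4-walks on genuine 4-cycles come in eights. The degenerate ones number 2∑d² - ∑d over the
degrees d, and d² is divisible by 4. -/
theorem eight_dvd_trace_pow_four_add (hA : IsEulerAdj A) :
    8 ∣ (A ^ 4).trace + ∑ i, ∑ j, A i j := by
  have h0 : (A ^ 4).trace = ∑ i, ∑ k, (A ^ 2) i k ^ 2 := by
    rw [show 4 = 2 + 2 from rfl, pow_add]
    simp only [Matrix.trace, Matrix.diag_apply, Matrix.mul_apply (M := A ^ 2)]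
    exact Finset.sum_congr rfl fun i _ => Finset.sum_congr rfl fun j _ => by
      rw [hA.sq_symm j i, pow_two ((A ^ 2) i j)]
  have hdiag : ∀ i, (A ^ 2) i i = ∑ j, A i j := fun i => by
    rw [pow_two, Matrix.mul_apply]
    exact Finset.sum_congr rfl fun j _ => by rw [hA.symm j i, hA.mul_self]
  -- The summand indicates that i, j, k, l is a 4-cycle with diagonals ik and jl.
  obtain ⟨m, hm⟩ := eight_dvd_sum_of_symm
    (fun i k j l => if i = k ∨ j = l then 0 else A i j * A j k * (A i l * A l k))
    (fun i k j l => by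
      simp only [eq_comm (a := i)]; congr 1
      rw [hA.symm i j, hA.symm i l, hA.symm j k, hA.symm l k]; ring)
    (fun i k j l => by simp only [eq_comm (a := j)]; congr 1; ring)
    (fun i k j l => by
      simp only [or_comm]; congr 1
      rw [hA.symm i j, hA.symm l k]; ring)
    (fun i j l => by simp) (fun i k => by simp [hA.diag])
  have hin : ∀ i k, (∑ j, ∑ l, if i = k ∨ j = l then 0 else A i j * A j k * (A i l * A l k)) =
      ((A ^ 2) i k ^ 2 - (A ^ 2) i k) - if i = k then (A ^ 2) i i ^ 2 - (A ^ 2) i i else 0 := by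
    intro i k
    by_cases hik : i = k
    · subst hik; simp
    · have : ∀ j l, (if i = k ∨ j = l then 0 else A i j * A j k * (A i l * A l k)) =
          A i j * A j k * (A i l * A l k) - if j = l then A i j * A j k else 0 := by
        intro j l
        by_cases hjl : j = l
        · subst hjl
          simp only [or_true, if_true]
          linear_combination (-A j k * A j k) * hA.mul_self i j - A i j * hA.mul_self j k
        · simp [hik, hjl]
      rw [if_neg hik, sub_zero, pow_two A, Matrix.mul_apply, pow_two, Finset.sum_mul_sum,
        ← Finset.sum_sub_distrib]
      refine Finset.sum_congr rfl fun j _ => ?_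
      rw [Finset.sum_congr rfl fun l _ => this j l, Finset.sum_sub_distrib,
        Finset.sum_ite_eq, if_pos (Finset.mem_univ _)]
  simp only [hin, Finset.sum_sub_distrib, Finset.sum_ite_eq, Finset.mem_univ, if_true, ← h0,
    hdiag, hA.sum_sum_sq] at hm
  choose f hf using hA.even
  simp only [hf, mul_pow, ← Finset.mul_sum] at hm ⊢
  exact ⟨m + ∑ i, f i ^ 2, by linarith⟩

end IsEulerAdj

/-! ### Newton's identities for the reversed characteristic polynomial -/

theorem Polynomial.coeff_prod_one_add_C_mul_X {R ι : Type*} [CommRing R] (s : Finset ι)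
    (a : ι → R) :
    let q : R[X] := ∏ i ∈ s, (1 + C (a i) * X)
    let p := fun k : ℕ => ∑ i ∈ s, a i ^ k
    q.coeff 0 = 1 ∧ q.coeff 1 = p 1 ∧ 2 * q.coeff 2 = p 1 ^ 2 - p 2 ∧
    6 * q.coeff 3 = p 1 ^ 3 - 3 * p 1 * p 2 + 2 * p 3 ∧
    24 * q.coeff 4 = p 1 ^ 4 - 6 * p 1 ^ 2 * p 2 + 3 * p 2 ^ 2 + 8 * p 1 * p 3 - 6 * p 4 := by
  classical
  induction s using Finset.induction_on with
  | empty => simp [coeff_one]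
  | insert i s hi ih =>
    obtain ⟨h0, h1, h2, h3, h4⟩ := ih
    have hs : ∀ k, (∏ j ∈ insert i s, (1 + C (a j) * X)).coeff (k + 1) =
        (∏ j ∈ s, (1 + C (a j) * X)).coeff (k + 1) +
          a i * (∏ j ∈ s, (1 + C (a j) * X)).coeff k := fun k => by
      rw [Finset.prod_insert hi, add_mul, one_mul, coeff_add, mul_assoc, coeff_C_mul, coeff_X_mul]
    dsimp only at h0 h1 h2 h3 h4 ⊢
    refine ⟨?_, ?_, ?_, ?_, ?_⟩
    · rw [Finset.prod_insert hi, mul_coeff_zero, h0]; simp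
    · rw [hs, h0, h1, Finset.sum_insert hi]; ring
    · rw [hs, h1, Finset.sum_insert hi, Finset.sum_insert hi]; linear_combination h2
    · rw [hs]; simp only [Finset.sum_insert hi]; linear_combination h3 + 3 * a i * h2
    · rw [hs]; simp only [Finset.sum_insert hi]; linear_combination h4 + 4 * a i * h3

namespace Matrix
variable {ι : Type*} [Fintype ι] [DecidableEq ι]

theorem charpolyRev_map {R S : Type*} [CommRing R] [CommRing S] (f : R →+* S)
    (M : Matrix ι ι R) : (M.map f).charpolyRev = M.charpolyRev.map f := by
  rw [charpolyRev, charpolyRev, ← coe_mapRingHom, RingHom.map_det]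
  congr 1
  ext i j : 1
  by_cases h : i = j <;> simp [h]

theorem IsHermitian.charpolyRev_eq {A : Matrix ι ι ℝ} (hA : A.IsHermitian) :
    A.charpolyRev = ∏ i, (1 + C (-hA.eigenvalues i) * X) := by
  have key : ∀ s : Finset ι, (∏ i ∈ s, (X - C (hA.eigenvalues i))).reverse =
      ∏ i ∈ s, (1 + C (-hA.eigenvalues i) * X) := fun s => by
    induction s using Finset.induction_on with
    | empty => simpa using reverse_C (1 : ℝ)
    | insert i s hi ih =>
      rw [Finset.prod_insert hi, Finset.prod_insert hi, reverse_mul_of_domain, ih]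
      congr 1
      rw [reverse, natDegree_X_sub_C, reflect_sub]
      have := reflect_C_mul_X_pow (R := ℝ) 1 1 (c := 1)
      simp [reflect_C, sub_eq_add_neg]
  rw [← reverse_charpoly, hA.charpoly_eq]
  exact key _

theorem IsHermitian.trace_pow {A : Matrix ι ι ℝ} (hA : A.IsHermitian) (k : ℕ) :
    (A ^ k).trace = ∑ i, hA.eigenvalues i ^ k := by
  conv_lhs => rw [hA.spectral_theorem, ← map_pow, Unitary.conjStarAlgAut_apply, trace_mul_comm,
    ← mul_assoc, Unitary.coe_star_mul_self, one_mul, diagonal_pow, trace_diagonal]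
  simp

/-- Diagonalise over ℝ and apply Newton's identities to the negated eigenvalues. -/
theorem coeff_charpolyRev_of_isSymm {A : Matrix ι ι ℤ} (hA : A.IsSymm) (h0 : A.trace = 0) :
    A.charpolyRev.coeff 0 = 1 ∧ A.charpolyRev.coeff 1 = 0 ∧
    2 * A.charpolyRev.coeff 2 = -(A ^ 2).trace ∧
    3 * A.charpolyRev.coeff 3 = -(A ^ 3).trace ∧
    24 * A.charpolyRev.coeff 4 = 3 * (A ^ 2).trace ^ 2 - 6 * (A ^ 4).trace := by
  set f := Int.castRingHom ℝ
  have hH : (A.map f).IsHermitian := by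
    ext i j
    simp [conjTranspose_apply, hA.apply i j]
  have ht : ∀ k, ∑ i, hH.eigenvalues i ^ k = (((A ^ k).trace : ℤ) : ℝ) := fun k => by
    rw [← hH.trace_pow, ← Matrix.map_pow]
    simp [trace, f]
  have ht1 : ∑ i, hH.eigenvalues i = 0 := by simpa [h0] using ht 1
  have hc : ∀ k, (A.charpolyRev.coeff k : ℝ) =
      (∏ i, (1 + C (-hH.eigenvalues i) * X)).coeff k := fun k => by
    rw [← hH.charpolyRev_eq, charpolyRev_map, coeff_map]; rfl
  obtain ⟨c0, c1, c2, c3, c4⟩ :=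
    coeff_prod_one_add_C_mul_X Finset.univ fun i => -hH.eigenvalues i
  simp only [← hc, neg_pow (hH.eigenvalues _), ← Finset.mul_sum, ht, pow_one, ht1] at c0 c1 c2 c3 c4
  norm_num [ht1] at c0 c2 c3 c4
  refine ⟨by exact_mod_cast c0, by simp [h0], by exact_mod_cast c2, ?_,
    by exact_mod_cast c4⟩
  have : (3 * A.charpolyRev.coeff 3 : ℝ) = -(A ^ 3).trace := by linarith
  exact_mod_cast this

end Matrix

/-! ### Truncation modulo 32 -/

namespace Matrix
variable {ι : Type*} [Fintype ι] [DecidableEq ι]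

/-- The matrix determinant lemma for the rank-one J; 1 + 2zA is inverted by a geometric series that
stops because (2z)⁵ = 0. -/
theorem det_one_sub_smul_ones_sub {R : Type*} [CommRing R] (h32 : (32 : R) = 0)
    (A : Matrix ι ι R) (z : R) :
    (1 - z • ((of fun _ _ => 1 : Matrix ι ι R) - (2 : R) • A)).det = (1 + (2 * z) • A).det *
      (1 - z * ∑ j ∈ Finset.range 5, (-(2 * z)) ^ j * ((1 : ι → R) ⬝ᵥ (A ^ j) *ᵥ 1)) := by
  set N := (2 * z) • A with hN
  set V := ∑ j ∈ Finset.range 5, (-N) ^ j with hV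
  have hpow : (-N) ^ 5 = 0 := by
    rw [hN, ← neg_smul, _root_.smul_pow, show (-(2 * z)) ^ 5 = 32 * (-z ^ 5) by ring, h32, zero_mul,
      zero_smul]
  have hinv : (1 + N) * V = 1 := by
    have := mul_neg_geom_sum (-N) 5
    rwa [sub_neg_eq_add, hpow, sub_zero] at this
  have h1 : ∃ U : Matrix ι Unit R, U = replicateCol Unit (-z • (1 : ι → R)) ∧
      replicateCol Unit (V *ᵥ (-z • (1 : ι → R))) = V * U :=
    ⟨_, rfl, by ext i j; simp [mul_apply, mulVec, dotProduct]⟩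
  obtain ⟨U, hU, hVU⟩ := h1
  obtain ⟨W, hW⟩ : ∃ W : Matrix Unit ι R, W = replicateRow Unit 1 := ⟨_, rfl⟩
  have hfac : 1 - z • ((of fun _ _ => 1 : Matrix ι ι R) - (2 : R) • A) = (1 + N) * (1 + V * U * W) := by
    rw [mul_add, mul_one, Matrix.mul_assoc V, ← Matrix.mul_assoc (1 + N), hinv, Matrix.one_mul]
    ext i j
    simp [hN, mul_apply, hU, hW]
    ring
  rw [hfac, det_mul, ← hVU, hW, det_one_add_replicateCol_mul_replicateRow]
  congr 1
  rw [mulVec_smul, dotProduct_smul, hV, sum_mulVec, dotProduct_sum, smul_eq_mul, neg_mul,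
    ← sub_eq_add_neg]
  congr 2
  refine Finset.sum_congr rfl fun j _ => ?_
  rw [hN, ← neg_smul, _root_.smul_pow, smul_mulVec, dotProduct_smul, smul_eq_mul]

theorem det_one_add_two_mul_smul {R : Type*} [CommRing R] (h32 : (32 : R) = 0)
    (A : Matrix ι ι ℤ) (z : R) :
    (1 + (2 * z) • A.map (Int.castRingHom R)).det =
      ∑ k ∈ Finset.range 5, (A.charpolyRev.coeff k : R) * (-(2 * z)) ^ k := by
  set y := -(2 * z) with hy
  have hdet : (1 + (2 * z) • A.map (Int.castRingHom R)).det =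
      eval₂RingHom (Int.castRingHom R) y A.charpolyRev := by
    rw [charpolyRev, RingHom.map_det]
    congr 1
    ext i j : 1
    rw [RingHom.mapMatrix_apply, map_apply]
    have hk : ∀ k : ℤ, eval₂ (Int.castRingHom R) (-(2 * z)) (k : ℤ[X]) = k :=
      fun k => map_intCast (eval₂RingHom (Int.castRingHom R) (-(2 * z))) k
    by_cases h : i = j <;> simp [h, hy, hk]
  have hy5 : y ^ 5 = 0 := by
    rw [show y ^ 5 = 32 * (-z ^ 5) by rw [hy]; ring, h32, zero_mul]
  rw [hdet, coe_eval₂RingHom,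
    eval₂_eq_sum_range' _ (lt_add_of_pos_right A.charpolyRev.natDegree (show 0 < 5 by norm_num)),
    Nat.add_comm, Finset.sum_range_add, Finset.sum_eq_zero (s := Finset.range _) (f := fun x => _ * y ^ (5 + x))]
  · simp
  · intro k _
    rw [pow_add, hy5]; simp

end Matrix

namespace IsEulerAdj
open Matrix
variable {ι : Type*} [Fintype ι] {A : Matrix ι ι ℤ} [DecidableEq ι]

/-- Write A1 = 2f and move one factor A across the product: each longer walk count is 4 times a form
in f, with f·f ≡ ∑f = E and fᵀAf ≡ 0 mod 2. -/
theorem walks (hA : IsEulerAdj A) {E : ℤ} (hE : ∑ i, ∑ j, A i j = 2 * E) :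
    (1 ⬝ᵥ (A ^ 1) *ᵥ 1) = 2 * E ∧ 8 ∣ (1 ⬝ᵥ (A ^ 2) *ᵥ 1) - 4 * E ∧
      8 ∣ (1 ⬝ᵥ (A ^ 3) *ᵥ 1) ∧ 4 ∣ (1 ⬝ᵥ (A ^ 4) *ᵥ 1) := by
  choose f hf using hA.even
  have hu : A *ᵥ 1 = (2 : ℤ) • f := by ext i; simp [mulVec, dotProduct, hf]
  have hv : ∀ v w : ι → ℤ, v ⬝ᵥ A *ᵥ w = A *ᵥ v ⬝ᵥ w := fun v w => by
    rw [dotProduct_mulVec, ← mulVec_transpose, hA.isSymm.eq]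
  have hfE : ∑ i, f i = E := by
    have : 2 * ∑ i, f i = 2 * E := by rw [← hE, Finset.mul_sum]; simp [hf]
    linarith
  have hf2 : 2 ∣ f ⬝ᵥ f - E := by
    rw [← hfE, dotProduct, ← Finset.sum_sub_distrib]
    exact Finset.dvd_sum fun i _ => by
      have := Int.even_mul_pred_self (f i)
      rw [mul_sub, mul_one] at this
      exact this.two_dvd
  have hf3 : 2 ∣ f ⬝ᵥ A *ᵥ f := by
    simp only [dotProduct, mulVec, Finset.mul_sum]
    exact two_dvd_sum_sum_of_symm _ (fun i j => by rw [hA.symm]; ring) fun i => by simp [hA.diag]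
  refine ⟨?_, ?_, ?_, ?_⟩
  · rw [pow_one, hu, dotProduct_smul, one_dotProduct, hfE, smul_eq_mul]
  · rw [pow_two, ← mulVec_mulVec, hv, hu]
    obtain ⟨m, hm⟩ := hf2
    refine ⟨m, ?_⟩
    simp only [dotProduct_smul, smul_dotProduct, smul_eq_mul]
    linarith
  · rw [pow_succ, pow_two, ← mulVec_mulVec, ← mulVec_mulVec, hv, hu]
    obtain ⟨m, hm⟩ := hf3
    refine ⟨m, ?_⟩
    simp only [mulVec_smul, dotProduct_smul, smul_dotProduct, smul_eq_mul, hm]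
    ring
  · rw [pow_succ, pow_succ, pow_two, ← mulVec_mulVec, ← mulVec_mulVec, ← mulVec_mulVec, hv, hv, hu]
    simp only [mulVec_smul, dotProduct_smul, smul_dotProduct, smul_eq_mul, ← mul_assoc]
    exact ⟨_, by norm_num; rfl⟩

end IsEulerAdj

/-- The residue modulo `32` of the reversed characteristic polynomial of `S + 1`, for `S` the Seidel
matrix of a graph with even degrees, `49` vertices, `e` edges and `t` triangles. -/
noncomputable def eulerCharpolyRev (e t : ZMod 32) : (ZMod 32)[X] :=
  1 - 17 * X + C (20 * e + 16 * t) * X ^ 3 + C (8 * e * (e + 1) + 16 * e + 16 * t) * X ^ 4 +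
    C (8 * e * (e + 1)) * X ^ 5

namespace IsEulerAdj
open Matrix
variable {ι : Type*} [Fintype ι] {A : Matrix ι ι ℤ} [DecidableEq ι]

theorem charpolyRev_map (hA : IsEulerAdj A) (hn : Fintype.card ι = 49) {E t : ℤ}
    (hE : ∑ i, ∑ j, A i j = 2 * E) (ht : (A ^ 3).trace = 6 * t) :
    ((of fun _ _ => 1 : Matrix ι ι ℤ) - (2 : ℤ) • A).charpolyRev.map (Int.castRingHom (ZMod 32)) =
      eulerCharpolyRev E t := by
  have h32 : (32 : (ZMod 32)[X]) = 0 := by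
    have : (32 : ZMod 32) = 0 := by decide
    rw [← map_ofNat C 32, this, map_zero]
  set B : Matrix ι ι (ZMod 32)[X] := A.map (Int.castRingHom _) with hB
  have hdet : ((of fun _ _ => 1 : Matrix ι ι ℤ) - (2 : ℤ) • A).charpolyRev.map (Int.castRingHom (ZMod 32)) =
      (1 - (X : (ZMod 32)[X]) •
        ((of fun _ _ => 1 : Matrix ι ι (ZMod 32)[X]) - (2 : (ZMod 32)[X]) • B)).det := by
    rw [← Matrix.charpolyRev_map, charpolyRev]
    congr 3
    ext i j : 1
    simp [hB]
    rw [two_mul, two_mul, Matrix.add_apply, Int.cast_add]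
  have hw : ∀ j, ((1 : ι → (ZMod 32)[X]) ⬝ᵥ (B ^ j) *ᵥ 1) =
      ((1 ⬝ᵥ (A ^ j) *ᵥ 1 : ℤ) : (ZMod 32)[X]) := fun j => by
    rw [hB, ← Matrix.map_pow]
    simp [mulVec, dotProduct]
  obtain ⟨c0, c1, c2, c3, c4⟩ := coeff_charpolyRev_of_isSymm hA.isSymm hA.trace_eq_zero
  rw [hA.trace_sq, hE] at c2 c4
  obtain ⟨m, hm⟩ := hA.eight_dvd_trace_pow_four_add
  obtain ⟨w1, ⟨m2, w2⟩, ⟨m3, w3⟩, ⟨m4, w4⟩⟩ := hA.walks hE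
  have w0 : (1 ⬝ᵥ (A ^ 0) *ᵥ 1 : ℤ) = 49 := by
    simp [hn]
  rw [hE] at hm
  rw [ht] at c3
  rw [hdet, det_one_sub_smul_ones_sub h32, hB, det_one_add_two_mul_smul h32, ← hB]
  simp only [Finset.sum_range_succ, Finset.sum_range_zero, hw, w0, w1, w3, w4, c0, c1,
    show A.charpolyRev.coeff 2 = -E by linarith, show A.charpolyRev.coeff 3 = -(2 * t) by linarith,
    show (1 ⬝ᵥ (A ^ 2) *ᵥ 1 : ℤ) = 4 * E + 8 * m2 by linarith]
  have c4' : 2 * A.charpolyRev.coeff 4 = E * (E + 1) - 4 * m := by linarith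
  have c4'' : (2 * (A.charpolyRev.coeff 4 : (ZMod 32)[X])) = E * (E + 1) - 4 * m := by
    exact_mod_cast congrArg (Int.cast (R := (ZMod 32)[X])) c4'
  generalize A.charpolyRev.coeff 4 = c at c4''
  simp only [eulerCharpolyRev, map_add, map_mul, map_ofNat, map_one, map_intCast]
  push_cast
  -- Makes 16E(E+1) a multiple of 32.
  obtain ⟨n, hn'⟩ := (Int.even_mul_succ_self E).two_dvd
  have hn'' : (E * (E + 1) : (ZMod 32)[X]) = 2 * n := by exact_mod_cast congrArg Int.cast hn'
  generalize (E : (ZMod 32)[X]) = E at *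
  generalize (t : (ZMod 32)[X]) = t at *
  generalize (c : (ZMod 32)[X]) = c at *
  generalize (n : (ZMod 32)[X]) = n at *
  generalize (m : (ZMod 32)[X]) = m at *
  generalize (m2 : (ZMod 32)[X]) = m2 at *
  generalize (m3 : (ZMod 32)[X]) = m3 at *
  generalize (m4 : (ZMod 32)[X]) = m4 at *
  linear_combination 8 * X ^ 4 * (1 - X * (49 - 2 * X * (2 * E) + 4 * X ^ 2 * (4 * E + 8 * m2) -
      8 * X ^ 3 * (8 * m3) + 16 * X ^ 4 * (4 * m4))) * c4'' - (16 * X ^ 4 + 336 * X ^ 5) * hn'' + (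
      (-1) * X + (5) * E * X ^ 3 + (-1) * m2 * X ^ 3 + (2) * m3 * X ^ 4 + (-2) * m4 * X ^ 5 +
      (4) * E * m2 * X ^ 5 + (-8) * E * m3 * X ^ 6 + (8) * E * m4 * X ^ 7 +
      (2) * E * t * X ^ 5 + (-25) * t * X ^ 4 + (-8) * E * t * X ^ 6 + (-16) * t * m2 * X ^ 6 +
      (32) * t * m3 * X ^ 7 + (-32) * t * m4 * X ^ 8 + (-1) * m * X ^ 4 + (1) * E ^ 3 * X ^ 6 +
      (1) * E ^ 2 * X ^ 6 + (-4) * E * m * X ^ 6 + (49) * m * X ^ 5 + (-4) * E ^ 3 * X ^ 7 +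
      (-4) * E ^ 2 * X ^ 7 + (16) * E * m * X ^ 7 + (-8) * E ^ 2 * m2 * X ^ 7 +
      (-8) * E * m2 * X ^ 7 + (32) * m * m2 * X ^ 7 + (16) * E ^ 2 * m3 * X ^ 8 +
      (16) * E * m3 * X ^ 8 + (-64) * m * m3 * X ^ 8 + (-16) * E ^ 2 * m4 * X ^ 9 +
      (-16) * E * m4 * X ^ 9 + (64) * m * m4 * X ^ 9 + (-n) * X ^ 4 + (-21) * n * X ^ 5 +
      (-2) * E * X ^ 5) * h32

end IsEulerAdj

/-! ### Passing between S and S + 1 modulo 32 -/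

theorem mk_span_C_eq_iff_map_eq (n : ℕ) (p q : ℤ[X]) :
    Ideal.Quotient.mk (Ideal.span {(C (n : ℤ) : ℤ[X])}) p = Ideal.Quotient.mk _ q ↔
      p.map (Int.castRingHom (ZMod n)) = q.map (Int.castRingHom (ZMod n)) := by
  rw [Ideal.Quotient.eq, Ideal.mem_span_singleton, C_dvd_iff_dvd_coeff, Polynomial.ext_iff]
  refine forall_congr' fun i => ?_
  rw [coeff_map, coeff_map, coeff_sub, ← ZMod.intCast_zmod_eq_zero_iff_dvd, Int.cast_sub,
    sub_eq_zero]
  rfl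

namespace Matrix
variable {ι : Type*} [Fintype ι] [DecidableEq ι] {R : Type*} [CommRing R] [Nontrivial R]

theorem charpolyRev_inj {M N : Matrix ι ι R} :
    M.charpolyRev = N.charpolyRev ↔ M.charpoly = N.charpoly := by
  rw [← reverse_charpoly, ← reverse_charpoly, reverse, reverse, charpoly_natDegree_eq_dim,
    charpoly_natDegree_eq_dim]
  refine ⟨fun h => ?_, fun h => by rw [h]⟩
  simpa using congrArg (reflect (Fintype.card ι)) h

theorem charpoly_sub_one_inj {R : Type*} [CommRing R] {M N : Matrix ι ι R} :
    (M - 1).charpoly = (N - 1).charpoly ↔ M.charpoly = N.charpoly := by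
  have h : ∀ M : Matrix ι ι R, (M - 1).charpoly = M.charpoly.comp (X + C 1) := fun M => by
    rw [← charpoly_sub_scalar, map_one]
  rw [h, h]
  refine ⟨fun e => ?_, fun e => by rw [e]⟩
  have e' := congrArg (fun p => p.comp (X - C 1)) e
  simpa only [comp_assoc, add_comp, X_comp, C_comp, sub_add_cancel, comp_X] using e'

end Matrix

open Matrix in
/-- Modulo `32`, the characteristic polynomial of `M - 1` and the reversed characteristic polynomial
of `M` determine each other. -/
theorem mk_charpoly_eq_iff {ι : Type*} [Fintype ι] [DecidableEq ι] (M N : Matrix ι ι ℤ) :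
    Ideal.Quotient.mk (Ideal.span {(C 32 : ℤ[X])}) (M - 1).charpoly =
      Ideal.Quotient.mk (Ideal.span {(C 32 : ℤ[X])}) (N - 1).charpoly ↔
    M.charpolyRev.map (Int.castRingHom (ZMod 32)) =
      N.charpolyRev.map (Int.castRingHom (ZMod 32)) := by
  have : Fact (1 < 32) := ⟨by norm_num⟩
  have h := mk_span_C_eq_iff_map_eq 32 (M - 1).charpoly (N - 1).charpoly
  have h1 : ∀ M : Matrix ι ι ℤ, (M - 1).map (Int.castRingHom (ZMod 32)) =
    M.map (Int.castRingHom (ZMod 32)) - 1 := fun M => by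
      ext i j
      by_cases h : i = j <;> simp [h]
  rw [Nat.cast_ofNat] at h
  rw [h, ← charpoly_map, ← charpoly_map, h1, h1, charpoly_sub_one_inj, ← charpolyRev_inj,
    Matrix.charpolyRev_map, Matrix.charpolyRev_map]

/-! ### Switching to an Eulerian graph -/

open Matrix in
/-- Switching turns a Seidel matrix of order `49` into that of a graph with even degrees. -/
theorem IsSeidelMatrix.exists_isEulerAdj {ι : Type*} [Fintype ι] [DecidableEq ι]
    (hn : Fintype.card ι = 49) {S : Matrix ι ι ℤ} (hS : IsSeidelMatrix S) :
    ∃ A : Matrix ι ι ℤ, IsEulerAdj A ∧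
      S.charpoly = ((of fun _ _ => 1 : Matrix ι ι ℤ) - (2 : ℤ) • A - 1).charpoly := by
  have hadj : ∀ T : Matrix ι ι ℤ, IsSeidelMatrix T → ∃ A : Matrix ι ι ℤ, (∀ i j, A i j = A j i) ∧
      (∀ i, A i i = 0) ∧ (∀ i j, A i j = 0 ∨ A i j = 1) ∧
      T = (of fun _ _ => 1 : Matrix ι ι ℤ) - (2 : ℤ) • A - 1 := by
    intro T hT
    refine ⟨of fun i j => if i = j then 0 else (1 - T i j) / 2, fun i j => ?_, fun i => by simp,
      fun i j => ?_, ?_⟩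
    · simp [eq_comm (a := i), hT.isSymm.apply i j]
    · rcases eq_or_ne i j with h | h
      · simp [h]
      · rcases hT.off_diag i j h with e | e <;> simp [h, e]
    · ext i j
      rcases eq_or_ne i j with h | h
      · simp [h, hT.diag_eq_zero]
      · rcases hT.off_diag i j h with e | e <;> simp [h, e]
  obtain ⟨B, hB1, hB2, hB3, hB⟩ := hadj S hS
  -- Switch at the set U of odd-degree vertices. As |U| is even and 49 - |U| odd, exactly the
  -- degrees in U change parity.
  set u : ι → ℤ := fun i => (∑ j, B i j) % 2 with hu
  have hu01 : ∀ i, u i = 0 ∨ u i = 1 := fun i => Int.emod_two_eq _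
  set d : ι → ℤ := fun i => 1 - 2 * u i with hd
  have hd1 : ∀ i, d i = 1 ∨ d i = -1 := fun i => by
    rcases hu01 i with h | h <;> simp [hd, h]
  have hdd : diagonal d * diagonal d = 1 := by
    rw [diagonal_mul_diagonal, ← diagonal_one]
    congr 1
    ext i
    rcases hd1 i with h | h <;> simp [h]
  have hT : IsSeidelMatrix (diagonal d * S * diagonal d) := by
    refine ⟨IsSymm.ext fun i j => ?_, fun i => ?_, fun i j h => ?_⟩
    · simp [hS.isSymm.apply i j]; ring
    · simp [hS.diag_eq_zero]
    · simp only [mul_diagonal, diagonal_mul]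
      rcases hd1 i with e | e <;> rcases hd1 j with e' | e' <;>
        rcases hS.off_diag i j h with e'' | e'' <;> simp [e, e', e'']
  obtain ⟨A, hA1, hA2, hA3, hA⟩ := hadj _ hT
  refine ⟨A, ⟨hA1, hA2, hA3, fun i => ?_⟩, ?_⟩
  · have hU : 2 ∣ ∑ i, u i := by
      have h1 := two_dvd_sum_sum_of_symm B hB1 hB2
      have h2 : 2 ∣ ∑ i, ∑ j, B i j - ∑ i, u i := by
        rw [← Finset.sum_sub_distrib]
        exact Finset.dvd_sum fun i _ => by simp only [hu]; omega
      omega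
    have e1 : ∀ j, 2 * A i j = 1 - (1 : Matrix ι ι ℤ) i j - d i * S i j * d j := fun j => by
      have := congrFun (congrFun hA i) j
      simp [-zsmul_eq_mul, Matrix.smul_apply] at this
      linarith
    have e2 : ∀ j, S i j * d j = 1 - (1 : Matrix ι ι ℤ) i j - 2 * B i j - 2 * u j
        + 2 * ((1 : Matrix ι ι ℤ) i j * u j) + 4 * (u j * B i j) := fun j => by
      have := congrFun (congrFun hB i) j
      simp [-zsmul_eq_mul, Matrix.smul_apply] at this
      rw [this]; simp only [hd]; ring
    have e3 : 2 * ∑ j, A i j = 49 - 1 - d i * ∑ j, S i j * d j := by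
      rw [Finset.mul_sum, Finset.mul_sum, Finset.sum_congr rfl fun j _ => e1 j]
      simp [Finset.sum_sub_distrib, one_apply, hn, mul_assoc]
    have e4 : ∑ j, S i j * d j = 49 - 1 - 2 * ∑ j, B i j - 2 * ∑ j, u j + 2 * u i +
        4 * ∑ j, u j * B i j := by
      rw [Finset.sum_congr rfl fun j _ => e2 j]
      simp [Finset.sum_sub_distrib, Finset.sum_add_distrib, one_apply, hn, ← Finset.mul_sum]
    have e5 : u i = (∑ j, B i j) % 2 := rfl
    rcases hd1 i with h | h <;> rw [h] at e3 <;> omega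
  · rw [← hA, charpoly_mul_comm, ← Matrix.mul_assoc, hdd, Matrix.one_mul]

/-- Divisibility of tr A³ by 3 comes from the integrality of the cubic coefficient. -/
theorem IsEulerAdj.exists_edges_triangles {ι : Type*} [Fintype ι] [DecidableEq ι]
    {A : Matrix ι ι ℤ} (hA : IsEulerAdj A) :
    ∃ E t : ℤ, ∑ i, ∑ j, A i j = 2 * E ∧ (A ^ 3).trace = 6 * t := by
  obtain ⟨E, hE⟩ := two_dvd_sum_sum_of_symm A hA.symm hA.diag
  have h2 := hA.two_dvd_trace_pow_three
  have h3 := (Matrix.coeff_charpolyRev_of_isSymm hA.isSymm hA.trace_eq_zero).2.2.2.1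
  exact ⟨E, (A ^ 3).trace / 6, hE, by omega⟩

/-! ### Representatives of the 16 classes -/

/-- A cycle of length `m`, with a disjoint triangle if `b = 1`. -/
def cycleTriangle (m b : ℕ) : Matrix (Fin 14) (Fin 14) ℤ :=
  Matrix.of fun i j =>
    if (i : ℕ) < m ∧ (j : ℕ) < m ∧ (((i : ℕ) + 1) % m = j ∨ ((j : ℕ) + 1) % m = i) ∨
      b = 1 ∧ 11 ≤ (i : ℕ) ∧ 11 ≤ (j : ℕ) ∧ i ≠ j then 1 else 0

namespace cycleTriangle

theorem diag : ∀ (a : Fin 8) (b : Fin 2) (i : Fin 14), cycleTriangle (a + 4) b i i = 0 := by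
  decide +kernel

theorem symm (m b : ℕ) (i j : Fin 14) : cycleTriangle m b i j = cycleTriangle m b j i :=
  if_congr (by rw [ne_comm]; tauto) rfl rfl

theorem zero_or_one (m b : ℕ) (i j : Fin 14) :
    cycleTriangle m b i j = 0 ∨ cycleTriangle m b i j = 1 := by
  simp only [cycleTriangle, Matrix.of_apply]
  split_ifs <;> simp

theorem even : ∀ (a : Fin 8) (b : Fin 2) (i : Fin 14),
    2 ∣ ∑ j, cycleTriangle (a + 4) b i j := by
  decide +kernel

theorem edges : ∀ (a : Fin 8) (b : Fin 2),
    ∑ i, ∑ j, cycleTriangle (a + 4) b i j = 2 * (a + 4 + 3 * b : ℕ) := by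
  decide +kernel

theorem triangles : ∀ (a : Fin 8) (b : Fin 2),
    ∑ i, ∑ j, cycleTriangle (a + 4) b i j *
      ∑ k, cycleTriangle (a + 4) b j k * cycleTriangle (a + 4) b k i = 6 * (b : ℕ) := by
  decide +kernel

end cycleTriangle

theorem eulerCharpolyRev_eq_iff {e t e' t' : ZMod 32} :
    eulerCharpolyRev e t = eulerCharpolyRev e' t' ↔
      20 * e + 16 * t = 20 * e' + 16 * t' ∧
      8 * e * (e + 1) + 16 * e + 16 * t = 8 * e' * (e' + 1) + 16 * e' + 16 * t' ∧
      8 * e * (e + 1) = 8 * e' * (e' + 1) := by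
  have key : ∀ a b c a' b' c' : ZMod 32,
      1 - 17 * X + C a * X ^ 3 + C b * X ^ 4 + C c * X ^ 5 =
        1 - 17 * X + C a' * X ^ 3 + C b' * X ^ 4 + C c' * X ^ 5 → a = a' ∧ b = b' ∧ c = c' := by
    intro a b c a' b' c' h
    simp only [add_assoc, add_right_inj] at h
    refine ⟨?_, ?_, ?_⟩
    · simpa [coeff_X_pow] using congrArg (coeff · 3) h
    · simpa [coeff_X_pow] using congrArg (coeff · 4) h
    · simpa [coeff_X_pow] using congrArg (coeff · 5) h
  exact ⟨key _ _ _ _ _ _, fun ⟨h1, h2, h3⟩ => by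
    rw [eulerCharpolyRev, eulerCharpolyRev, h1, h2, h3]⟩

/-- The number of edges of the graph given by `cycleTriangle (p.1 + 4) p.2`. -/
def cycleTriangleEdges (p : Fin 8 × Fin 2) : ℕ := p.1 + 4 + 3 * p.2

/-- With cᵢ the coefficient of Xⁱ, c₄ - c₅ = 16(e + t) and c₃ - (c₄ - c₅) = 4e, which recover e mod
8 and t mod 2. -/
theorem eulerCharpolyRev_cycleTriangle_injective : Function.Injective fun p : Fin 8 × Fin 2 =>
    eulerCharpolyRev (cycleTriangleEdges p) (p.2 : ℕ) := by
  intro p q h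
  rw [eulerCharpolyRev_eq_iff] at h
  revert p q
  decide +kernel

theorem exists_eulerCharpolyRev_cycleTriangle_eq (e t : ZMod 32) : ∃ p : Fin 8 × Fin 2,
    eulerCharpolyRev (cycleTriangleEdges p) (p.2 : ℕ) = eulerCharpolyRev e t := by
  simp only [eulerCharpolyRev_eq_iff]
  revert e t
  decide +kernel

-- Cycle lengths 4 to 11 cover all residues mod 8 and add no triangle; 35 isolated vertices complete
-- the order to 49.
open Matrix in
theorem exists_isEulerAdj_cycleTriangle (p : Fin 8 × Fin 2) :
    ∃ A : Matrix (Fin 14 ⊕ Fin 35) (Fin 14 ⊕ Fin 35) ℤ, IsEulerAdj A ∧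
      ∑ i, ∑ j, A i j = 2 * (cycleTriangleEdges p : ℤ) ∧ (A ^ 3).trace = 6 * ((p.2 : ℕ) : ℤ) := by
  set B := cycleTriangle (p.1 + 4) p.2 with hB
  refine ⟨fromBlocks B 0 0 0, ⟨?_, ?_, ?_, ?_⟩, ?_, ?_⟩
  · rintro (i | i) (j | j) <;> simp [hB]
    exact cycleTriangle.symm _ _ i j
  · rintro (i | i) <;> simp [hB, cycleTriangle.diag]
  · rintro (i | i) (j | j) <;> simp [hB]
    exact cycleTriangle.zero_or_one _ _ i j
  · rintro (i | i) <;> simp [hB, cycleTriangle.even]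
  · simpa [cycleTriangleEdges] using cycleTriangle.edges p.1 p.2
  · rw [pow_succ', pow_two, fromBlocks_multiply, fromBlocks_multiply]
    simpa [trace, mul_apply] using cycleTriangle.triangles p.1 p.2

open Matrix in
theorem IsEulerAdj.isSeidelMatrix {ι : Type*} [Fintype ι] [DecidableEq ι] {A : Matrix ι ι ℤ}
    (hA : IsEulerAdj A) :
    IsSeidelMatrix ((of fun _ _ => 1 : Matrix ι ι ℤ) - (2 : ℤ) • A - 1) := by
  refine ⟨IsSymm.ext fun i j => ?_, fun i => ?_, fun i j h => ?_⟩
  · simp [-zsmul_eq_mul, hA.symm i j, one_apply, eq_comm (a := i)]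
  · simp [-zsmul_eq_mul, hA.diag]
  · rcases hA.zero_or_one i j with e | e <;> simp [-zsmul_eq_mul, h, e]

open Matrix in
theorem IsEulerAdj.submatrix {ι κ : Type*} [Fintype ι] [Fintype κ] {A : Matrix ι ι ℤ}
    (hA : IsEulerAdj A) (e : κ ≃ ι) : IsEulerAdj (A.submatrix e e) where
  symm i j := hA.symm (e i) (e j)
  diag i := hA.diag (e i)
  zero_or_one i j := hA.zero_or_one (e i) (e j)
  even i := by
    have := hA.even (e i)
    rwa [← e.sum_comp] at this

theorem trace_submatrix_pow {ι κ R : Type*} [Fintype ι] [Fintype κ] [DecidableEq ι]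
    [DecidableEq κ] [CommRing R] (A : Matrix ι ι R) (e : κ ≃ ι) (k : ℕ) :
    (A.submatrix e e ^ k).trace = (A ^ k).trace := by
  have h : A.submatrix e e ^ k = (A ^ k).submatrix e e :=
    (map_pow (Matrix.reindexAlgEquiv R R e.symm) A k).symm
  rw [h]
  exact e.sum_comp fun i => (A ^ k) i i

open Matrix in
theorem exists_isSeidelMatrix_cycleTriangle (p : Fin 8 × Fin 2) :
    ∃ M : Matrix (Fin 49) (Fin 49) ℤ, IsSeidelMatrix (M - 1) ∧
      M.charpolyRev.map (Int.castRingHom (ZMod 32)) =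
        eulerCharpolyRev (cycleTriangleEdges p) (p.2 : ℕ) := by
  obtain ⟨A, hA, hE, ht⟩ := exists_isEulerAdj_cycleTriangle p
  set e : Fin 49 ≃ Fin 14 ⊕ Fin 35 := (finSumFinEquiv (m := 14) (n := 35)).symm
  have hA' := hA.submatrix e
  refine ⟨_, hA'.isSeidelMatrix, ?_⟩
  rw [hA'.charpolyRev_map (E := cycleTriangleEdges p) (t := (p.2 : ℕ)) (by simp)]
  · simp
  · rw [← hE, ← e.sum_comp]
    exact Finset.sum_congr rfl fun i _ => e.sum_comp fun j => A (e i) j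
  · rw [← ht, ← trace_submatrix_pow A e]

theorem mainTheorem9 : (seidelCharpolyClasses 49 32).ncard = 16 := by
  choose M hM hrev using exists_isSeidelMatrix_cycleTriangle
  have hrange : seidelCharpolyClasses 49 32 = Set.range fun p =>
      Ideal.Quotient.mk (Ideal.span {(C 32 : ℤ[X])}) (M p - 1).charpoly := by
    ext q
    constructor
    · rintro ⟨S, hS, rfl⟩
      obtain ⟨A, hA, hSA⟩ := hS.exists_isEulerAdj (Fintype.card_fin 49)
      obtain ⟨E, t, hE, ht⟩ := hA.exists_edges_triangles
      obtain ⟨p, hp⟩ := exists_eulerCharpolyRev_cycleTriangle_eq E t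
      refine ⟨p, ?_⟩
      rw [hSA]
      refine (mk_charpoly_eq_iff _ _).2 ?_
      rw [hrev, hp, hA.charpolyRev_map (Fintype.card_fin 49) hE ht]
    · rintro ⟨p, rfl⟩
      exact ⟨_, hM p, rfl⟩
  rw [hrange, ← Set.image_univ, Set.ncard_image_of_injective, Set.ncard_univ]
  · simp
  · intro p q h
    have h' := (mk_charpoly_eq_iff _ _).1 h
    rw [hrev, hrev] at h'
    exact eulerCharpolyRev_cycleTriangle_injective h'
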